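/- Let $k\ge 1$ be an integer, let $R=\frac{1}{k+1}$, and let $p>0$ be a real number with $R>p$. Let $X_{i,j}$ ($i\ge 1$, $0\le j\le k$) be independent random variables with $P(X_{i,j}=1)=p$ and $P(X_{i,j}=0)=1-p$, put $X_i=\sum_{j=0}^{k}X_{i,j}-1$, let $Y_0$ be a random variable with values in $\{0,1,2,\dots\}$ that is independent of the $X_{i,j}$, and let $Y_n=\max(Y_{n-1}+X_n,0)$ for $n\ge 1$. Then $\{Y_n\}_{n\ge 0}$ is a homogeneous Markov chain, with transition probabilities $$a_{i,j}:=P(Y_n=j\mid Y_{n-1}=i)=\sum_{\substack{0\le u\le k+1\\ \max(i+u-1,\,0)=j}}\binom{k+1}{u}p^u(1-p)^{k+1-u}\qquad(i,j\ge 0).$$ The first equality is for all $n\ge 1$ and $i$ with $P(Y_{n-1}=i)>0$; the sum defines $a_{i,j}$ for all $i,j\ge 0$. Let $a^{(n)}_{i,j}$ denote the entries of the $n$-th power of the matrix $(a_{i,j})_{i,j\ge 0}$. The chain is irreducible and every state is positive recurrent (the chain started in it returns to it almost surely, with finite mean return time). The chain admits a stationary distribution $\pi$, given by $$\pi_i=\lim_{n\to\infty}a^{(n)}_{j,i}\qquad\text{for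 all } i,j\ge 0;$$ in particular the limits exist and do not depend on the starting state $j$. If $Y_0$ has law $\pi$, then $P(Y_n=i)=\pi_i$ for all $n,i\ge 0$. -/

import Mathlib

open MeasureTheory ProbabilityTheory Filter Topology
open scoped ENNReal

namespace Tetrys

noncomputable section

/-! Markov chains on the countable state space of natural numbers, given by an infinite matrix of
transition probabilities. Entries lie in the extended non-negative reals, so that all infinite sums
below are meaningful. -/

/-- The entries `a i j ^ (n)` of the `n`-th power of the infinite matrix `a`. -/
def nStep (a : ℕ → ℕ → ℝ≥0∞) : ℕ → ℕ → ℕ → ℝ≥0∞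
  | 0, i, j => if i = j then 1 else 0
  | n + 1, i, j => ∑' l, nStep a n i l * a l j

/-- `firstPassage a n i j` is the probability that the chain with transition matrix `a` started
in `i` is in `j` at time `n ≥ 1` and at no time `m` with `1 ≤ m < n`
(for `i = j`: the probability that the first return to `i` happens at time `n`). -/
def firstPassage (a : ℕ → ℕ → ℝ≥0∞) : ℕ → ℕ → ℕ → ℝ≥0∞
  | 0, _, _ => 0
  | 1, i, j => a i j
  | n + 2, i, j => ∑' l, if l = j then 0 else a i l * firstPassage a (n + 1) l j

/-- Every state can be reached from every state with positive probability. -/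
def IsIrreducible (a : ℕ → ℕ → ℝ≥0∞) : Prop :=
  ∀ i j, ∃ n, 0 < nStep a n i j

/-- State `i` is positive recurrent: the chain started in `i` returns to `i` with probability one,
and the mean return time is finite. -/
def PositiveRecurrent (a : ℕ → ℕ → ℝ≥0∞) (i : ℕ) : Prop :=
  ∑' n, firstPassage a n i i = 1 ∧ ∑' n : ℕ, (n : ℝ≥0∞) * firstPassage a n i i < ∞

/-- `π` is a probability distribution on the states with `π a = π`. -/
def IsStationaryDistribution (a : ℕ → ℕ → ℝ≥0∞) (π : ℕ → ℝ≥0∞) : Prop :=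
  ∑' i, π i = 1 ∧ ∀ j, ∑' i, π i * a i j = π j

/-- The process `Y` is a homogeneous Markov chain with transition matrix `a`: conditionally on any
past of positive probability, the next state has the law given by the row of the current state. -/
def IsMarkovChain {Ω : Type*} [MeasurableSpace Ω] (μ : Measure Ω) (Y : ℕ → Ω → ℕ)
    (a : ℕ → ℕ → ℝ≥0∞) : Prop :=
  ∀ (n : ℕ) (y : ℕ → ℕ), μ {ω | ∀ m ≤ n, Y m ω = y m} ≠ 0 →
    ∀ j, μ[{ω | Y (n + 1) ω = j} | {ω | ∀ m ≤ n, Y m ω = y m}] = a (y n) j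

/-! The model: one repair packet is sent after every `k` source packets, and packets are lost
independently with probability `p`. -/

/-- The redundancy ratio `R`: one packet in each block of `k + 1` packets is a repair packet. -/
def redundancyRatio (k : ℕ) : ℝ := 1 / ((k : ℝ) + 1)

/-- The update of the chain: `y + x` if this is non-negative, and `0` otherwise. -/
def update (y : ℕ) (x : ℤ) : ℕ :=
  if 0 ≤ (y : ℤ) + x then ((y : ℤ) + x).toNat else 0

/-- `a i j`, the probability of `update i x = j` when `x = u - 1` with probability
`(k + 1).choose u * p ^ u * (1 - p) ^ (k + 1 - u)`, for `u = 0, …, k + 1`. -/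
def transition (k : ℕ) (p : ℝ) (i j : ℕ) : ℝ≥0∞ :=
  ∑ u ∈ Finset.range (k + 2), if update i ((u : ℤ) - 1) = j then
    ENNReal.ofReal (((k + 1).choose u : ℝ) * p ^ u * (1 - p) ^ (k + 1 - u)) else 0

/-- A Bernoulli channel of loss rate `p`, with an initial state independent of the losses.
`X n j` is `1` if the packet in position `j` of the block number `n + 1` is lost
and `0` if it is received; position `k` is that of the repair packet. -/
structure IsBernoulliChannel {Ω : Type*} [MeasurableSpace Ω] (μ : Measure Ω) (k : ℕ) (p : ℝ)
    (X : ℕ → Fin (k + 1) → Ω → ℕ) (Y₀ : Ω → ℕ) : Prop where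
  measurable_loss : ∀ n j, Measurable (X n j)
  prob_lost : ∀ n j, μ {ω | X n j ω = 1} = ENNReal.ofReal p
  prob_received : ∀ n j, μ {ω | X n j ω = 0} = ENNReal.ofReal (1 - p)
  indep_loss : iIndepFun (fun q : ℕ × Fin (k + 1) => X q.1 q.2) μ
  measurable_init : Measurable Y₀
  indep_init : IndepFun Y₀ (fun ω (q : ℕ × Fin (k + 1)) => X q.1 q.2 ω) μ

/-- The increment of the block number `n + 1`: the number of lost packets of the block, minus one
(equivalently, lost source packets minus received repair packets). -/
def increment {Ω : Type*} {k : ℕ} (X : ℕ → Fin (k + 1) → Ω → ℕ) (n : ℕ) (ω : Ω) : ℤ :=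
  (∑ j, (X n j ω : ℤ)) - 1

/-- The chain `Y n`: lost packets minus received repair packets since the last decoding,
observed after the block number `n`. -/
def chain {Ω : Type*} {k : ℕ} (X : ℕ → Fin (k + 1) → Ω → ℕ) (Y₀ : Ω → ℕ) : ℕ → Ω → ℕ
  | 0, ω => Y₀ ω
  | n + 1, ω => update (chain X Y₀ n ω) (increment X n ω)

end

end Tetrys

/-!
Write `w u` for the binomial probability of `u` losses in a block. The update of the chain is
`i ↦ i + u - 1` with truncated subtraction, so one step acts on functions `f` by
`f ↦ (i ↦ ∑ u, w u * f (i + u - 1))` (`expect_transition`), and everything analytic about the chain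
is read off the iterates of this operator (`tsum_nStep_mul`).

The assumption `p < 1 / (k + 1)` says that fewer than one loss is expected per block. Hence there
are `z > 1` and `ρ < 1` with `∑ u, w u * z ^ u = ρ * z` (`exists_weight_drift`): the mean of
`z ^ Y` contracts by the factor `ρ` as long as the chain is not in `0`.

*Positive recurrence.* By Foster's criterion (`PositiveRecurrent.of_drift`) it suffices to find a
finite function `W` that decreases by at least `1` in the mean along the chain killed in the
target `i`. Above `i` a multiple of `z ^ l` serves, because the chain goes down by single steps and
cannot jump over `i`; below `i` the finitely many states need a separate function, which exists
since upward steps have positive probability (`positiveRecurrent_transition`).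

*Convergence.* The update is monotone in the state. So the chain started in `0` increases
stochastically, and its tail probabilities converge. The chains started in `0` and in `j` and driven
by the same losses merge when the upper one visits `0`, which costs at most `ρ ^ n * z ^ j`
(`iterate_expect_transition_le`). So the limits do not depend on the starting state. Boundedness of
the mean of `z ^ Y` keeps mass from escaping to infinity (`tendsto_limitTail`), whence the limit is
a probability distribution. Only finitely many states lead to a given one, so stationarity passes
to the limit (`isStationaryDistribution_limitLaw`).

*The Markov property.* A path event is an event of the initial state and of the first `n`
increments (`setOf_chain_eq`), hence independent of the next increment, whose law is binomial
(`measure_sum_eq_binomial`).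
-/

namespace Tetrys

/-! ### Kernels as operators on functions -/

/-- The action of a matrix `a` on functions: `expect a f i` is the mean of `f` after one step of the
chain started in `i`. -/
noncomputable def expect (a : ℕ → ℕ → ℝ≥0∞) (f : ℕ → ℝ≥0∞) (i : ℕ) : ℝ≥0∞ :=
  ∑' j, a i j * f j

theorem tsum_nStep_mul (a : ℕ → ℕ → ℝ≥0∞) (n : ℕ) (f : ℕ → ℝ≥0∞) (i : ℕ) :
    ∑' j, nStep a n i j * f j = (expect a)^[n] f i := by
  induction n generalizing f with
  | zero => simp [nStep]
  | succ n ih =>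
    rw [Function.iterate_succ_apply, ← ih]
    simp only [nStep, expect, ← ENNReal.tsum_mul_right, ← ENNReal.tsum_mul_left, mul_assoc]
    exact ENNReal.tsum_comm

theorem expect_mono (a : ℕ → ℕ → ℝ≥0∞) : Monotone (expect a) :=
  fun _ _ h i => ENNReal.tsum_le_tsum fun j => by gcongr; exact h j

theorem expect_add (a : ℕ → ℕ → ℝ≥0∞) (f g : ℕ → ℝ≥0∞) :
    expect a (f + g) = expect a f + expect a g := by
  funext i
  simp [expect, mul_add, ENNReal.tsum_add]

theorem expect_const_mul (a : ℕ → ℕ → ℝ≥0∞) (c : ℝ≥0∞) (f : ℕ → ℝ≥0∞) (i : ℕ) :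
    expect a (fun j => c * f j) i = c * expect a f i := by
  simp only [expect, ← ENNReal.tsum_mul_left]
  exact tsum_congr fun j => by ring

theorem iterate_expect_add (a : ℕ → ℕ → ℝ≥0∞) (n : ℕ) (f g : ℕ → ℝ≥0∞) :
    (expect a)^[n] (f + g) = (expect a)^[n] f + (expect a)^[n] g := by
  induction n generalizing f g with
  | zero => rfl
  | succ n ih => simp only [Function.iterate_succ_apply, expect_add, ih]

theorem iterate_expect_const_mul (a : ℕ → ℕ → ℝ≥0∞) (n : ℕ) (c : ℝ≥0∞) (f : ℕ → ℝ≥0∞) (i : ℕ) :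
    (expect a)^[n] (fun j => c * f j) i = c * (expect a)^[n] f i := by
  rw [← tsum_nStep_mul, ← tsum_nStep_mul, ← ENNReal.tsum_mul_left]
  exact tsum_congr fun j => by ring

theorem iterate_expect_mono (a : ℕ → ℕ → ℝ≥0∞) (n : ℕ) : Monotone ((expect a)^[n]) :=
  (expect_mono a).iterate n

theorem iterate_expect_const {a : ℕ → ℕ → ℝ≥0∞} (ha : ∀ i, ∑' j, a i j = 1) (n : ℕ) (c : ℝ≥0∞) :
    (expect a)^[n] (fun _ => c) = fun _ => c := by
  apply Function.iterate_fixed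
  funext i
  simp [expect, ENNReal.tsum_mul_right, ha]

/-! ### A drift criterion for positive recurrence -/

/-- `survival a i n l` is the probability that the chain started in `l` avoids `i` at the times
`1, …, n`. -/
noncomputable def survival (a : ℕ → ℕ → ℝ≥0∞) (i : ℕ) : ℕ → ℕ → ℝ≥0∞
  | 0, _ => 1
  | n + 1, l => ∑' m, if m = i then 0 else a l m * survival a i n m

theorem firstPassage_add_survival {a : ℕ → ℕ → ℝ≥0∞} (ha : ∀ i, ∑' j, a i j = 1) (i n l : ℕ) :
    firstPassage a (n + 1) l i + survival a i (n + 1) l = survival a i n l := by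
  induction n generalizing l with
  | zero =>
    simp only [firstPassage, survival, mul_one]
    rw [← ha l, ENNReal.tsum_eq_add_tsum_ite (f := a l) i]
    congr!
  | succ n ih =>
    rw [survival, firstPassage, ← ENNReal.tsum_add, survival]
    refine tsum_congr fun m => ?_
    split_ifs
    · simp
    · rw [← mul_add, ih]

theorem sum_firstPassage_add_survival {a : ℕ → ℕ → ℝ≥0∞} (ha : ∀ i, ∑' j, a i j = 1) (i N l : ℕ) :
    ∑ n ∈ Finset.range N, firstPassage a (n + 1) l i + survival a i N l = 1 := by
  induction N with
  | zero => simp [survival]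
  | succ N ih => rw [Finset.sum_range_succ, add_assoc, firstPassage_add_survival ha, ih]

/-- Summation by parts: the truncated mean passage time is the sum of the survival
probabilities. -/
theorem sum_mul_firstPassage_add_survival {a : ℕ → ℕ → ℝ≥0∞} (ha : ∀ i, ∑' j, a i j = 1)
    (i N l : ℕ) :
    ∑ n ∈ Finset.range N, ((n + 1 : ℕ) : ℝ≥0∞) * firstPassage a (n + 1) l i + N * survival a i N l =
      ∑ n ∈ Finset.range N, survival a i n l := by
  induction N with
  | zero => simp
  | succ N ih =>
    rw [Finset.sum_range_succ, Finset.sum_range_succ, ← ih, add_assoc, ← mul_add,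
      firstPassage_add_survival ha]
    push_cast
    ring

theorem sum_survival_le {a : ℕ → ℕ → ℝ≥0∞} {i : ℕ} {W : ℕ → ℝ≥0∞}
    (hW : ∀ l, (∑' m, if m = i then 0 else a l m * W m) + 1 ≤ W l) (N l : ℕ) :
    ∑ n ∈ Finset.range N, survival a i n l ≤ W l := by
  induction N generalizing l with
  | zero => simp
  | succ N ih =>
    rw [Finset.sum_range_succ']
    refine le_trans ?_ (hW l)
    simp only [survival]
    gcongr
    rw [← Summable.tsum_finsetSum fun _ _ => ENNReal.summable]
    refine ENNReal.tsum_le_tsum fun m => ?_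
    split_ifs
    · simp
    · rw [← Finset.mul_sum]
      gcongr
      exact ih m

/-- Foster's criterion: a non-negative function `W`, finite at `i`, that decreases by at least `1`
in the mean along the chain killed on entering `i` bounds the mean return time of `i`. -/
theorem PositiveRecurrent.of_drift {a : ℕ → ℕ → ℝ≥0∞} (ha : ∀ i, ∑' j, a i j = 1) {i : ℕ}
    {W : ℕ → ℝ≥0∞} (hW : ∀ l, (∑' m, if m = i then 0 else a l m * W m) + 1 ≤ W l)
    (hi : W i ≠ ∞) : PositiveRecurrent a i := by
  have hsum : ∑' n, survival a i n i ≤ W i :=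
    ENNReal.tsum_le_of_sum_range_le fun N => sum_survival_le hW N i
  have h0 : Tendsto (fun n => survival a i n i) atTop (𝓝 0) :=
    ENNReal.tendsto_atTop_zero_of_tsum_ne_top (ne_top_of_le_ne_top hi hsum)
  constructor
  · rw [tsum_eq_zero_add' ENNReal.summable]
    have h1 := (ENNReal.tendsto_nat_tsum fun n => firstPassage a (n + 1) i i).add h0
    simp only [sum_firstPassage_add_survival ha, add_zero] at h1
    rw [firstPassage, zero_add]
    exact tendsto_nhds_unique h1 tendsto_const_nhds
  · rw [tsum_eq_zero_add' ENNReal.summable, Nat.cast_zero, zero_mul, zero_add]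
    refine lt_of_le_of_lt (ENNReal.tsum_le_of_sum_range_le fun N => ?_) hi.lt_top
    refine le_trans ?_ (sum_survival_le hW N i)
    rw [← sum_mul_firstPassage_add_survival ha]
    exact le_self_add

/-! ### The transition matrix -/

/-- The probability that `u` of the `k + 1` packets of a block are lost. -/
noncomputable def weight (k : ℕ) (p : ℝ) (u : ℕ) : ℝ≥0∞ :=
  ENNReal.ofReal (((k + 1).choose u : ℝ) * p ^ u * (1 - p) ^ (k + 1 - u))

theorem update_sub_one (i u : ℕ) : update i ((u : ℤ) - 1) = i + u - 1 := by
  unfold update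
  split_ifs <;> omega

theorem transition_eq (k : ℕ) (p : ℝ) (i j : ℕ) : transition k p i j =
    ∑ u ∈ Finset.range (k + 2), if i + u - 1 = j then weight k p u else 0 := by
  simp only [transition, update_sub_one, weight]

theorem expect_transition (k : ℕ) (p : ℝ) (f : ℕ → ℝ≥0∞) (i : ℕ) :
    expect (transition k p) f i = ∑ u ∈ Finset.range (k + 2), weight k p u * f (i + u - 1) := by
  simp only [expect, transition_eq, Finset.sum_mul]
  rw [Summable.tsum_finsetSum fun _ _ => ENNReal.summable]
  refine Finset.sum_congr rfl fun u _ => ?_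
  simp [ite_mul]

theorem sum_weight_mul_pow (k : ℕ) {p : ℝ} (hp : 0 ≤ p) (hp1 : p ≤ 1) {z : ℝ} (hz : 0 ≤ z) :
    ∑ u ∈ Finset.range (k + 2), weight k p u * ENNReal.ofReal z ^ u =
      ENNReal.ofReal ((p * z + (1 - p)) ^ (k + 1)) := by
  have h1 : 0 ≤ 1 - p := by linarith
  rw [add_pow, ENNReal.ofReal_sum_of_nonneg fun u _ => by positivity]
  refine Finset.sum_congr rfl fun u _ => ?_
  rw [weight, ← ENNReal.ofReal_pow hz, ← ENNReal.ofReal_mul (by positivity), mul_pow]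
  congr 1
  ring

theorem sum_weight (k : ℕ) {p : ℝ} (hp : 0 ≤ p) (hp1 : p ≤ 1) :
    ∑ u ∈ Finset.range (k + 2), weight k p u = 1 := by
  simpa using sum_weight_mul_pow k hp hp1 zero_le_one

theorem tsum_transition (k : ℕ) {p : ℝ} (hp : 0 ≤ p) (hp1 : p ≤ 1) (i : ℕ) :
    ∑' j, transition k p i j = 1 := by
  simpa [expect, sum_weight k hp hp1] using expect_transition k p (fun _ => 1) i

theorem weight_pos {k : ℕ} {p : ℝ} (hp : 0 < p) (hp1 : p < 1) {u : ℕ} (hu : u ≤ k + 1) :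
    0 < weight k p u := by
  have h1 : 0 < 1 - p := by linarith
  have h2 : 0 < (k + 1).choose u := Nat.choose_pos hu
  exact ENNReal.ofReal_pos.2 (by positivity)

theorem transition_pos {k : ℕ} {p : ℝ} (hp : 0 < p) (hp1 : p < 1) {i u : ℕ} (hu : u ≤ k + 1) :
    0 < transition k p i (i + u - 1) := by
  rw [transition_eq]
  refine lt_of_lt_of_le (weight_pos hp hp1 hu) ?_
  have := Finset.single_le_sum (f := fun v => if i + v - 1 = i + u - 1 then weight k p v else 0)
    (fun _ _ => zero_le) (Finset.mem_range.2 (show u < k + 2 by omega))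
  simpa using this

theorem nStep_pos_trans {a : ℕ → ℕ → ℝ≥0∞} {i j l : ℕ} (h : ∃ n, 0 < nStep a n i j)
    (hjl : 0 < a j l) : ∃ n, 0 < nStep a n i l := by
  obtain ⟨n, hn⟩ := h
  exact ⟨n + 1, lt_of_lt_of_le (ENNReal.mul_pos hn.ne' hjl.ne')
    (ENNReal.le_tsum (f := fun l' => nStep a n i l' * a l' l) j)⟩

/-- A block without loss moves the chain down by one and a block with two losses moves it up by one,
so that all states communicate. -/
theorem isIrreducible_transition {k : ℕ} (hk : 1 ≤ k) {p : ℝ} (hp : 0 < p) (hp1 : p < 1) :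
    IsIrreducible (transition k p) := by
  intro i j
  have down : ∀ m, (∃ n, 0 < nStep (transition k p) n i (i - m)) := by
    intro m
    induction m with
    | zero => exact ⟨0, by simp [nStep]⟩
    | succ m ih => exact nStep_pos_trans ih (transition_pos (u := 0) hp hp1 (by omega))
  induction j with
  | zero => simpa using down i
  | succ j ih => exact nStep_pos_trans ih (transition_pos (u := 2) hp hp1 (by omega))

/-! ### The exponential drift -/

/-- As the mean number `(k + 1) * p` of losses per block is below `1`, the generating function
`z ↦ (p * z + (1 - p)) ^ (k + 1)` lies strictly below `z` just to the right of its fixed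
point `1`. -/
theorem exists_pow_lt {k : ℕ} {p : ℝ} (hR : p < redundancyRatio k) :
    ∃ z : ℝ, 1 < z ∧ (p * z + (1 - p)) ^ (k + 1) < z := by
  have hd : HasDerivAt (fun z : ℝ => (p * z + (1 - p)) ^ (k + 1) - z) ((k + 1) * p - 1) 1 := by
    refine HasDerivAt.congr_deriv (((((hasDerivAt_id' (1 : ℝ)).const_mul p).add_const
      (1 - p)).fun_pow (k + 1)).fun_sub (hasDerivAt_id' (1 : ℝ))) ?_
    simp
  have hneg : ((k : ℝ) + 1) * p - 1 < 0 := by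
    have hk : (0 : ℝ) < k + 1 := by positivity
    rw [redundancyRatio, lt_div_iff₀ hk] at hR
    linarith
  have hs := (hasDerivAt_iff_tendsto_slope.1 hd).eventually (gt_mem_nhds hneg)
  have hs' : ∀ᶠ z in 𝓝[>] (1 : ℝ), slope (fun z : ℝ => (p * z + (1 - p)) ^ (k + 1) - z) 1 z < 0 :=
    hs.filter_mono (nhdsWithin_mono _ fun z hz => ne_of_gt hz)
  obtain ⟨z, hz, hz1⟩ := (hs'.and self_mem_nhdsWithin).exists
  have hz1 : 1 < z := hz1
  refine ⟨z, hz1, ?_⟩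
  rw [slope_def_field, div_neg_iff] at hz
  have : p * 1 + (1 - p) = 1 := by ring
  rw [this, one_pow] at hz
  rcases hz with h | h <;> linarith

theorem exists_weight_drift {k : ℕ} {p : ℝ} (hp : 0 < p) (hp1 : p < 1)
    (hR : p < redundancyRatio k) :
    ∃ z ρ : ℝ≥0∞, 1 < z ∧ z ≠ ∞ ∧ ρ < 1 ∧
      ∑ u ∈ Finset.range (k + 2), weight k p u * z ^ u = ρ * z := by
  obtain ⟨z, hz1, hz⟩ := exists_pow_lt hR
  have hz0 : 0 < z := by linarith
  refine ⟨ENNReal.ofReal z, ENNReal.ofReal ((p * z + (1 - p)) ^ (k + 1) / z),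
    by simpa using hz1, ENNReal.ofReal_ne_top, ?_, ?_⟩
  · rw [ENNReal.ofReal_lt_one, div_lt_one hz0]
    exact hz
  · rw [sum_weight_mul_pow k hp.le hp1.le hz0.le, ← ENNReal.ofReal_mul, div_mul_cancel₀ _ hz0.ne']
    have : 0 ≤ p * z + (1 - p) := by nlinarith
    positivity

/-- Away from `0` the mean of `z ^ Y` contracts. -/
theorem sum_weight_mul_pow_sub_one {k : ℕ} {p : ℝ} {z ρ : ℝ≥0∞}
    (h : ∑ u ∈ Finset.range (k + 2), weight k p u * z ^ u = ρ * z)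
    {i : ℕ} (hi : i ≠ 0) :
    ∑ u ∈ Finset.range (k + 2), weight k p u * z ^ (i + u - 1) = ρ * z ^ i := by
  obtain ⟨i, rfl⟩ := Nat.exists_eq_succ_of_ne_zero hi
  have : ∀ u, i.succ + u - 1 = i + u := fun u => by omega
  simp only [this, pow_add]
  rw [pow_succ']
  calc _ = z ^ i * ∑ u ∈ Finset.range (k + 2), weight k p u * z ^ u := by
        rw [Finset.mul_sum]
        exact Finset.sum_congr rfl fun u _ => by ring
    _ = _ := by rw [h]; ring

/-! ### Positive recurrence -/

/-- The drift criterion with the value of the Lyapunov function at the target set to `0`. -/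
theorem PositiveRecurrent.of_expect_drift {a : ℕ → ℕ → ℝ≥0∞} (ha : ∀ i, ∑' j, a i j = 1) {i : ℕ}
    {W : ℕ → ℝ≥0∞} (hi : W i = 0) (hW : ∀ l, l ≠ i → expect a W l + 1 ≤ W l)
    (hfin : expect a W i ≠ ∞) : PositiveRecurrent a i := by
  have key : ∀ l c, (∑' m, if m = i then 0 else a l m * Function.update W i c m) =
      expect a W l := by
    intro l c
    refine tsum_congr fun m => ?_
    by_cases hm : m = i
    · simp [hm, hi]
    · simp [hm]
  refine PositiveRecurrent.of_drift ha (W := Function.update W i (expect a W i + 1))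
    (fun l => ?_) (by simpa using hfin)
  rw [key]
  by_cases hl : l = i
  · simp [hl]
  · simpa [hl] using hW l hl

/-- Every state `i` is positive recurrent. The Lyapunov function is a multiple of `z ^ l` above `i`,
where the chain cannot jump over `i` on its way down. Below `i` it is a multiple of
`θ ^ i - θ ^ l`, with `θ` so large that the mean of `θ ^ Y` doubles by upward steps of size one
alone; the factor `K` pays for the jumps over `i`. -/
theorem positiveRecurrent_transition {k : ℕ} (hk : 1 ≤ k) {p : ℝ} (hp : 0 < p) (hp1 : p < 1)
    (hR : p < redundancyRatio k) (i : ℕ) : PositiveRecurrent (transition k p) i := by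
  obtain ⟨z, ρ, hz, hz', hρ, h⟩ := exists_weight_drift hp hp1 hR
  have hw2 : 0 < weight k p 2 := weight_pos hp hp1 (by omega)
  have hw2' : weight k p 2 ≠ ∞ := ENNReal.ofReal_ne_top
  have hwsum := sum_weight k hp.le hp1.le
  have hw2le : weight k p 2 ≤ 1 :=
    hwsum ▸ Finset.single_le_sum (f := weight k p) (fun _ _ => zero_le)
      (Finset.mem_range.2 (show 2 < k + 2 by omega))
  obtain ⟨θ, hθdef⟩ : ∃ θ, θ = 2 * (weight k p 2)⁻¹ := ⟨_, rfl⟩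
  have hθ : weight k p 2 * θ = 2 := by
    rw [hθdef, mul_left_comm, ENNReal.mul_inv_cancel hw2.ne' hw2', mul_one]
  have hθ1 : 1 ≤ θ := by
    rw [hθdef]
    calc (1 : ℝ≥0∞) ≤ 2 * 1 := by norm_num
      _ ≤ _ := by
        gcongr
        exact ENNReal.one_le_inv.2 hw2le
  have hθ' : θ ≠ ∞ := by
    rw [hθdef]
    exact ENNReal.mul_ne_top (by simp) (ENNReal.inv_ne_top.2 hw2.ne')
  obtain ⟨D, hD⟩ : ∃ D, D = (1 - ρ)⁻¹ := ⟨_, rfl⟩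
  have hDtop : D ≠ ∞ := by
    rw [hD]
    exact ENNReal.inv_ne_top.2 (tsub_pos_of_lt hρ).ne'
  have hDρ : D * ρ + 1 = D := by
    have h1 := tsum_eq_zero_add' (f := fun n => ρ ^ n) ENNReal.summable
    simp only [pow_succ, ENNReal.tsum_mul_right, ENNReal.tsum_geometric, pow_zero] at h1
    rw [hD, add_comm]
    exact h1.symm
  obtain ⟨B, hB⟩ : ∃ B, B = z ^ (i + k + 1) := ⟨_, rfl⟩
  have hBtop : B ≠ ∞ := hB ▸ ENNReal.pow_ne_top hz'
  obtain ⟨K, hK⟩ : ∃ K, K = D * B + 1 := ⟨_, rfl⟩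
  have hDB : D * B ≠ ∞ := ENNReal.mul_ne_top hDtop hBtop
  have hKtop : K ≠ ∞ := by
    rw [hK]
    exact ENNReal.add_ne_top.2 ⟨hDB, by simp⟩
  have hzB : ∀ l ≤ i, expect (transition k p) (fun m => z ^ m) l ≤ B := by
    intro l hl
    rw [expect_transition, ← one_mul B, ← hwsum, Finset.sum_mul, hB]
    refine Finset.sum_le_sum fun u hu => ?_
    have := Finset.mem_range.1 hu
    gcongr
    · exact hz.le
    · omega
  let W : ℕ → ℝ≥0∞ := fun l =>
    if l < i then K * θ ^ i - K * θ ^ l else if l = i then 0 else D * z ^ l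
  let g : ℕ → ℝ≥0∞ := fun l => if l ≤ i then θ ^ l else 0
  have hWg : ∀ m, W m + K * g m ≤ K * θ ^ i + D * z ^ m := by
    intro m
    rcases lt_trichotomy m i with hm | hm | hm
    · simp only [W, g, hm, hm.le, if_true]
      rw [tsub_add_cancel_of_le (by gcongr)]
      exact le_self_add
    · simp only [W, g, hm, lt_irrefl, if_true, if_false, le_refl, zero_add]
      exact le_self_add
    · simp only [W, g, hm.not_gt, hm.ne', hm.not_ge, if_false, mul_zero, add_zero]
      exact le_add_self
  have hone : ∀ n c, expect (transition k p) (fun _ => c) n = c := fun n c => by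
    have := iterate_expect_const (tsum_transition k hp.le hp1.le) 1 c
    exact congrFun this n
  have hexp : ∀ l ≤ i, expect (transition k p) W l + K * expect (transition k p) g l ≤
      K * θ ^ i + D * B := by
    intro l hl
    calc _ = expect (transition k p) (fun m => W m + K * g m) l := by
          rw [← expect_const_mul]
          exact (congrFun (expect_add _ W (fun m => K * g m)) l).symm
      _ ≤ expect (transition k p) (fun m => K * θ ^ i + D * z ^ m) l := expect_mono _ hWg l
      _ = K * θ ^ i + D * expect (transition k p) (fun m => z ^ m) l := by
          rw [← expect_const_mul]
          refine (congrFun (expect_add _ (fun _ => K * θ ^ i) (fun m => D * z ^ m)) l).trans ?_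
          simp [hone]
      _ ≤ _ := by
          gcongr
          exact hzB l hl
  refine PositiveRecurrent.of_expect_drift (tsum_transition k hp.le hp1.le) (W := W) (by simp [W])
    (fun l hl => ?_) ?_
  · rcases lt_or_gt_of_ne hl with hl | hl
    · have hg : 2 * θ ^ l ≤ expect (transition k p) g l := by
        rw [expect_transition, ← hθ]
        refine le_trans (le_of_eq ?_) (Finset.single_le_sum
          (f := fun u => weight k p u * g (l + u - 1)) (fun _ _ => zero_le)
          (Finset.mem_range.2 (show 2 < k + 2 by omega)))
        have : l + 2 - 1 = l + 1 := by omega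
        simp only [this, g, if_pos (show l + 1 ≤ i by omega)]
        ring
      have hWl : W l = K * θ ^ i - K * θ ^ l := by simp only [W, hl, if_true]
      rw [hWl]
      refine ENNReal.le_sub_of_add_le_right
        (ENNReal.mul_ne_top hKtop (ENNReal.pow_ne_top hθ')) ?_
      -- one copy of `K * θ ^ l ≥ K` absorbs the constants `1` and `D * B`
      refine (ENNReal.add_le_add_iff_right hDB).1 (le_trans ?_ (hexp l hl.le))
      calc expect (transition k p) W l + 1 + K * θ ^ l + D * B
          = expect (transition k p) W l + (K * θ ^ l + K * 1) := by rw [mul_one]; nth_rw 3 [hK]; ring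
        _ ≤ expect (transition k p) W l + (K * θ ^ l + K * θ ^ l) := by
            gcongr
            exact one_le_pow₀ hθ1
        _ = expect (transition k p) W l + K * (2 * θ ^ l) := by ring
        _ ≤ _ := by gcongr
    · have hWl : W l = D * z ^ l := by simp only [W, hl.not_gt, hl.ne', if_false]
      have hle : expect (transition k p) W l ≤ D * (ρ * z ^ l) := by
        rw [← sum_weight_mul_pow_sub_one h (show l ≠ 0 by omega), expect_transition,
          Finset.mul_sum]
        refine Finset.sum_le_sum fun u _ => ?_
        rw [mul_left_comm]
        gcongr
        have : ¬ l + u - 1 < i := by omega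
        simp only [W, this, if_false]
        split_ifs
        · exact zero_le
        · exact le_rfl
      rw [hWl]
      nth_rw 1 [← hDρ]
      rw [add_mul, one_mul, mul_assoc]
      exact add_le_add hle (one_le_pow₀ hz.le)
  · exact ne_top_of_le_ne_top (ENNReal.add_ne_top.2
      ⟨ENNReal.mul_ne_top hKtop (ENNReal.pow_ne_top hθ'), hDB⟩) (le_self_add.trans (hexp i le_rfl))

/-! ### Convergence to the stationary distribution -/

/-- The update is monotone in the state, hence so is the mean of a monotone function. -/
theorem monotone_expect_transition {k : ℕ} {p : ℝ} {f : ℕ → ℝ≥0∞} (hf : Monotone f) :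
    Monotone (expect (transition k p) f) := by
  intro i j hij
  simp only [expect_transition]
  gcongr with u
  exact hf (by omega)

theorem monotone_iterate_expect_transition {k : ℕ} {p : ℝ} (n : ℕ) {f : ℕ → ℝ≥0∞}
    (hf : Monotone f) : Monotone ((expect (transition k p))^[n] f) := by
  induction n with
  | zero => exact hf
  | succ n ih =>
    rw [Function.iterate_succ_apply']
    exact monotone_expect_transition ih

/-- Started in the least state, the chain is stochastically increasing in time. -/
theorem monotone_iterate_expect_transition_zero {k : ℕ} {p : ℝ} (hp : 0 < p) (hp1 : p < 1)
    {f : ℕ → ℝ≥0∞} (hf : Monotone f) :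
    Monotone fun n => (expect (transition k p))^[n] f 0 := by
  refine monotone_nat_of_le_succ fun n => ?_
  rw [Function.iterate_succ_apply', expect_transition]
  calc (expect (transition k p))^[n] f 0
      = ∑ u ∈ Finset.range (k + 2), weight k p u * (expect (transition k p))^[n] f 0 := by
        rw [← Finset.sum_mul, sum_weight k hp.le hp1.le, one_mul]
    _ ≤ _ := by
        gcongr with u
        exact monotone_iterate_expect_transition n hf zero_le

/-- The influence of the starting state `j` decays geometrically: chains started in `0` and in `j`
and driven by the same losses agree once the upper one has visited `0`. -/
theorem iterate_expect_transition_le {k : ℕ} {p : ℝ} (hp : 0 < p) (hp1 : p < 1) {z ρ : ℝ≥0∞}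
    (hz : 1 < z) (h : ∑ u ∈ Finset.range (k + 2), weight k p u * z ^ u = ρ * z)
    {f : ℕ → ℝ≥0∞} (hf : Monotone f) (hf1 : ∀ i, f i ≤ 1) (n j : ℕ) :
    (expect (transition k p))^[n] f j ≤ (expect (transition k p))^[n] f 0 + ρ ^ n * z ^ j := by
  induction n generalizing j with
  | zero =>
    simp only [Function.iterate_zero, id_eq, pow_zero, one_mul]
    exact le_add_left ((hf1 j).trans (one_le_pow₀ hz.le))
  | succ n ih =>
    rcases eq_or_ne j 0 with rfl | hj
    · exact le_self_add
    have hmono := monotone_iterate_expect_transition_zero (k := k) hp hp1 hf (Nat.le_succ n)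
    refine le_trans ?_ (add_le_add_left hmono _)
    rw [Function.iterate_succ_apply', expect_transition]
    calc _ ≤ ∑ u ∈ Finset.range (k + 2), weight k p u *
            ((expect (transition k p))^[n] f 0 + ρ ^ n * z ^ (j + u - 1)) := by
          gcongr with u
          exact ih _
      _ = (expect (transition k p))^[n] f 0 +
            ρ ^ n * ∑ u ∈ Finset.range (k + 2), weight k p u * z ^ (j + u - 1) := by
          simp only [mul_add, Finset.sum_add_distrib]
          rw [← Finset.sum_mul, sum_weight k hp.le hp1.le, one_mul, Finset.mul_sum]
          congr 1
          exact Finset.sum_congr rfl fun u _ => by ring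
      _ = _ := by
          rw [sum_weight_mul_pow_sub_one h hj]
          ring

/-- The indicator function of `{m, m + 1, …}`. -/
def tail (m i : ℕ) : ℝ≥0∞ := if m ≤ i then 1 else 0

theorem monotone_tail (m : ℕ) : Monotone (tail m) := by
  intro i j hij
  unfold tail
  split_ifs
  · exact le_rfl
  · omega
  · exact zero_le
  · exact le_rfl

theorem tail_le_one (m i : ℕ) : tail m i ≤ 1 := by
  unfold tail
  split_ifs <;> simp

theorem nStep_add_tail (a : ℕ → ℕ → ℝ≥0∞) (n j m : ℕ) :
    nStep a n j m + (expect a)^[n] (tail (m + 1)) j = (expect a)^[n] (tail m) j := by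
  have h : nStep a n j m = (expect a)^[n] (fun i => if i = m then 1 else 0) j := by
    rw [← tsum_nStep_mul]
    simp
  rw [h, ← Pi.add_apply, ← iterate_expect_add]
  refine congrFun (congrArg _ (funext fun i => ?_)) j
  simp only [Pi.add_apply, tail]
  split_ifs <;> first | omega | simp

/-- The mean of `z ^ Y` stays bounded along the chain started in `0`. -/
theorem iterate_expect_transition_pow_le {k : ℕ} {p : ℝ} (hp : 0 < p) (hp1 : p < 1) {z ρ : ℝ≥0∞}
    (hz : 1 < z) (hρ : ρ < 1)
    (h : ∑ u ∈ Finset.range (k + 2), weight k p u * z ^ u = ρ * z) (n : ℕ) :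
    (expect (transition k p))^[n] (fun i => z ^ i) 0 ≤ z * (1 - ρ)⁻¹ := by
  have hdrift : expect (transition k p) (fun i => z ^ i) ≤
      (fun i => ρ * z ^ i) + fun _ => z := by
    intro i
    rw [expect_transition, Pi.add_apply]
    rcases eq_or_ne i 0 with rfl | hi
    · -- in state `0` the truncated exponent satisfies `u - 1 ≤ u`
      calc _ ≤ ∑ u ∈ Finset.range (k + 2), weight k p u * z ^ u := by
            gcongr
            · exact hz.le
            · omega
        _ ≤ z := by
            rw [h]
            exact mul_le_of_le_one_left zero_le hρ.le
        _ ≤ _ := le_add_self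
    · rw [sum_weight_mul_pow_sub_one h hi]
      exact le_self_add
  have hbound : (expect (transition k p))^[n] (fun i => z ^ i) 0 ≤
      z * ∑ m ∈ Finset.range (n + 1), ρ ^ m := by
    induction n with
    | zero => simpa using hz.le
    | succ n ih =>
      rw [Function.iterate_succ_apply]
      refine (iterate_expect_mono _ n hdrift 0).trans ?_
      rw [iterate_expect_add, Pi.add_apply, iterate_expect_const_mul,
        iterate_expect_const (tsum_transition k hp.le hp1.le)]
      rw [Finset.sum_range_succ']
      simp only [pow_succ', ← Finset.mul_sum]
      rw [pow_zero, mul_add, mul_one, mul_left_comm]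
      gcongr
  refine hbound.trans ?_
  rw [← ENNReal.tsum_geometric]
  gcongr
  exact ENNReal.sum_le_tsum _

/-- Limits of the tail probabilities of the chain started in `0`, which increase in time. -/
noncomputable def limitTail (k : ℕ) (p : ℝ) (m : ℕ) : ℝ≥0∞ :=
  ⨆ n, (expect (transition k p))^[n] (tail m) 0

theorem iterate_expect_tail_le_one {k : ℕ} {p : ℝ} (hp : 0 < p) (hp1 : p < 1) (n m j : ℕ) :
    (expect (transition k p))^[n] (tail m) j ≤ 1 := by
  have := iterate_expect_mono (transition k p) n (show tail m ≤ fun _ => 1 from tail_le_one m) j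
  rwa [iterate_expect_const (tsum_transition k hp.le hp1.le)] at this

theorem limitTail_ne_top {k : ℕ} {p : ℝ} (hp : 0 < p) (hp1 : p < 1) (m : ℕ) :
    limitTail k p m ≠ ∞ :=
  ne_top_of_le_ne_top ENNReal.one_ne_top
    (iSup_le fun n => iterate_expect_tail_le_one hp hp1 n m 0)

theorem tendsto_iterate_expect_tail {k : ℕ} {p : ℝ} (hp : 0 < p) (hp1 : p < 1)
    (hR : p < redundancyRatio k) (m j : ℕ) :
    Tendsto (fun n => (expect (transition k p))^[n] (tail m) j) atTop (𝓝 (limitTail k p m)) := by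
  obtain ⟨z, ρ, hz, hz', hρ, h⟩ := exists_weight_drift hp hp1 hR
  have h0 : Tendsto (fun n => (expect (transition k p))^[n] (tail m) 0) atTop
      (𝓝 (limitTail k p m)) :=
    tendsto_atTop_iSup (monotone_iterate_expect_transition_zero hp hp1 (monotone_tail m))
  have h1 : Tendsto (fun n => ρ ^ n * z ^ j) atTop (𝓝 0) := by
    simpa using ENNReal.Tendsto.mul_const (ENNReal.tendsto_pow_atTop_nhds_zero_of_lt_one hρ)
      (Or.inr (ENNReal.pow_ne_top hz'))
  refine tendsto_of_tendsto_of_tendsto_of_le_of_le h0 (by simpa using h0.add h1) (fun n => ?_)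
    fun n => ?_
  · exact monotone_iterate_expect_transition n (monotone_tail m) zero_le
  · exact iterate_expect_transition_le hp hp1 hz h (monotone_tail m) (tail_le_one m) n j

/-- No mass escapes to infinity, by Markov's inequality for `z ^ Y`. -/
theorem tendsto_limitTail {k : ℕ} {p : ℝ} (hp : 0 < p) (hp1 : p < 1)
    (hR : p < redundancyRatio k) : Tendsto (limitTail k p) atTop (𝓝 0) := by
  obtain ⟨z, ρ, hz, hz', hρ, h⟩ := exists_weight_drift hp hp1 hR
  have hz0 : z ≠ 0 := (zero_lt_one.trans hz).ne'
  have hC : z * (1 - ρ)⁻¹ ≠ ∞ :=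
    ENNReal.mul_ne_top hz' (ENNReal.inv_ne_top.2 (tsub_pos_of_lt hρ).ne')
  have hle : ∀ m, limitTail k p m ≤ z⁻¹ ^ m * (z * (1 - ρ)⁻¹) := by
    intro m
    refine iSup_le fun n => ?_
    have htail : tail m ≤ fun i => z⁻¹ ^ m * z ^ i := by
      intro i
      unfold tail
      split_ifs with hmi
      · calc (1 : ℝ≥0∞) = z⁻¹ ^ m * z ^ m := by
              rw [← mul_pow, ENNReal.inv_mul_cancel hz0 hz', one_pow]
          _ ≤ z⁻¹ ^ m * z ^ i := by
              gcongr
              exact hz.le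
      · exact zero_le
    refine (iterate_expect_mono _ n htail 0).trans ?_
    rw [iterate_expect_const_mul]
    gcongr
    exact iterate_expect_transition_pow_le hp hp1 hz hρ h n
  refine tendsto_of_tendsto_of_tendsto_of_le_of_le tendsto_const_nhds ?_ (fun _ => zero_le) hle
  simpa using ENNReal.Tendsto.mul_const (ENNReal.tendsto_pow_atTop_nhds_zero_of_lt_one
    (ENNReal.inv_lt_one.2 hz)) (Or.inr hC)

/-- The limit law of the chain. -/
noncomputable def limitLaw (k : ℕ) (p : ℝ) (i : ℕ) : ℝ≥0∞ :=
  limitTail k p i - limitTail k p (i + 1)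

theorem tendsto_nStep_transition {k : ℕ} {p : ℝ} (hp : 0 < p) (hp1 : p < 1)
    (hR : p < redundancyRatio k) (j i : ℕ) :
    Tendsto (fun n => nStep (transition k p) n j i) atTop (𝓝 (limitLaw k p i)) := by
  have h := ENNReal.Tendsto.sub (tendsto_iterate_expect_tail hp hp1 hR i j)
    (tendsto_iterate_expect_tail hp hp1 hR (i + 1) j) (Or.inl (limitTail_ne_top hp hp1 i))
  refine h.congr fun n => ?_
  rw [← nStep_add_tail]
  exact ENNReal.add_sub_cancel_right (ne_top_of_le_ne_top ENNReal.one_ne_top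
    (iterate_expect_tail_le_one hp hp1 n (i + 1) j))

theorem sum_limitLaw_add_limitTail {k : ℕ} {p : ℝ} (hp : 0 < p) (hp1 : p < 1)
    (hR : p < redundancyRatio k) (N : ℕ) :
    ∑ i ∈ Finset.range N, limitLaw k p i + limitTail k p N = 1 := by
  refine tendsto_nhds_unique ((tendsto_finsetSum _ fun i _ =>
    tendsto_nStep_transition hp hp1 hR 0 i).add (tendsto_iterate_expect_tail hp hp1 hR N 0))
    (tendsto_const_nhds.congr fun n => ?_)
  induction N with
  | zero =>
    have : tail 0 = fun _ => 1 := by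
      funext i
      simp [tail]
    simp [this, iterate_expect_const (tsum_transition k hp.le hp1.le)]
  | succ N ih => rw [Finset.sum_range_succ, add_assoc, nStep_add_tail, ← ih]

theorem isStationaryDistribution_limitLaw {k : ℕ} {p : ℝ} (hp : 0 < p) (hp1 : p < 1)
    (hR : p < redundancyRatio k) :
    IsStationaryDistribution (transition k p) (limitLaw k p) := by
  constructor
  · have h := (ENNReal.tendsto_nat_tsum (limitLaw k p)).add (tendsto_limitTail hp hp1 hR)
    simp only [sum_limitLaw_add_limitTail hp hp1 hR, add_zero] at h
    exact tendsto_nhds_unique h tendsto_const_nhds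
  · intro j
    -- the chain moves down by at most one, so only the states `i ≤ j + 1` lead to `j`
    have hzero : ∀ i ∉ Finset.range (j + 2), transition k p i j = 0 := by
      intro i hi
      rw [Finset.mem_range] at hi
      rw [transition_eq]
      exact Finset.sum_eq_zero fun u _ => if_neg (by omega)
    have hfin : ∀ f : ℕ → ℝ≥0∞, ∑' i, f i * transition k p i j =
        ∑ i ∈ Finset.range (j + 2), f i * transition k p i j := fun f =>
      tsum_eq_sum fun i hi => by rw [hzero i hi, mul_zero]
    have hle : ∀ i, transition k p i j ≠ ∞ := fun i =>
      ne_top_of_le_ne_top ENNReal.one_ne_top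
        ((ENNReal.le_tsum j).trans (tsum_transition k hp.le hp1.le i).le)
    refine tendsto_nhds_unique ?_ ((tendsto_add_atTop_iff_nat 1).2
      (tendsto_nStep_transition hp hp1 hR 0 j))
    simp only [nStep, hfin]
    exact tendsto_finsetSum _ fun i _ =>
      ENNReal.Tendsto.mul_const (tendsto_nStep_transition hp hp1 hR 0 i) (Or.inr (hle i))

/-! ### The loss channel -/

/-- Along the path `y`, the chain is determined by its initial state and by the increments. -/
theorem setOf_chain_eq {Ω : Type*} {k : ℕ} (X : ℕ → Fin (k + 1) → Ω → ℕ) (Y₀ : Ω → ℕ) (n : ℕ)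
    (y : ℕ → ℕ) : {ω | ∀ m ≤ n, chain X Y₀ m ω = y m} =
    {ω | Y₀ ω = y 0} ∩ {ω | ∀ m < n, update (y m) (increment X m ω) = y (m + 1)} := by
  ext ω
  constructor
  · intro h
    refine ⟨h 0 (Nat.zero_le n), fun m hm => ?_⟩
    rw [← h m hm.le]
    exact h (m + 1) hm
  · rintro ⟨h0, h⟩ m
    induction m with
    | zero => exact fun _ => h0
    | succ m ih =>
      intro hm
      rw [chain, ih (by omega)]
      exact h m hm

/-! ### The law of the increments -/

section Channel

variable {Ω : Type*} [MeasurableSpace Ω] {μ : Measure Ω} {k : ℕ} {p : ℝ}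
  {X : ℕ → Fin (k + 1) → Ω → ℕ} {Y₀ : Ω → ℕ}

/-- A sum of independent variables with values in `{0, 1}`, each equal to `1` with probability `p`,
has a binomial law. -/
theorem measure_sum_eq_binomial [IsProbabilityMeasure μ] {ι : Type*} {Z : ι → Ω → ℕ}
    (hp : 0 ≤ p) (hp1 : p ≤ 1) (hZ : ∀ i, Measurable (Z i))
    (h1 : ∀ i, μ {ω | Z i ω = 1} = ENNReal.ofReal p)
    (h0 : ∀ i, μ {ω | Z i ω = 0} = ENNReal.ofReal (1 - p)) (hind : iIndepFun Z μ)
    (s : Finset ι) (u : ℕ) :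
    μ {ω | ∑ i ∈ s, Z i ω = u} =
      ENNReal.ofReal ((s.card.choose u : ℝ) * p ^ u * (1 - p) ^ (s.card - u)) := by
  classical
  have hq : 0 ≤ 1 - p := by linarith
  induction s using Finset.induction_on generalizing u with
  | empty =>
    rcases u with _ | u
    · simp
    · simp
  | insert i s hi ih =>
    have hS : Measurable fun ω => ∑ i ∈ s, Z i ω := Finset.measurable_fun_sum s fun i _ => hZ i
    have hindep : IndepFun (fun ω => ∑ i ∈ s, Z i ω) (Z i) μ := by
      have := hind.indepFun_finsetSum_of_notMem hZ hi
      convert this using 1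
      funext ω
      simp
    have hmul : ∀ a b, μ {ω | ∑ i ∈ s, Z i ω = a ∧ Z i ω = b} =
        μ {ω | ∑ i ∈ s, Z i ω = a} * μ {ω | Z i ω = b} := fun a b =>
      hindep.measure_inter_preimage_eq_mul {a} {b} (MeasurableSet.singleton a)
        (MeasurableSet.singleton b)
    have hae : ∀ᵐ ω ∂μ, Z i ω = 0 ∨ Z i ω = 1 := by
      have hd : Disjoint {ω | Z i ω = 0} {ω | Z i ω = 1} := by
        rw [Set.disjoint_left]
        intro ω h h'
        simp only [Set.mem_ofPred_eq] at h h'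
        omega
      have hm : MeasurableSet ({ω | Z i ω = 0} ∪ {ω | Z i ω = 1}) :=
        (hZ i (MeasurableSet.singleton 0)).union (hZ i (MeasurableSet.singleton 1))
      refine (prob_compl_eq_zero_iff hm).2 ?_
      rw [measure_union hd (hZ i (MeasurableSet.singleton 1)), h0, h1,
        ← ENNReal.ofReal_add hq hp]
      simp
    rw [Finset.card_insert_of_notMem hi]
    have hsplit : {ω | ∑ j ∈ insert i s, Z j ω = u} =ᵐ[μ]
        ({ω | ∑ j ∈ s, Z j ω = u ∧ Z i ω = 0} ∪
          {ω | ∑ j ∈ s, Z j ω + 1 = u ∧ Z i ω = 1} : Set Ω) := by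
      filter_upwards [hae] with ω hω
      refine propext ?_
      change ∑ j ∈ insert i s, Z j ω = u ↔
        (∑ j ∈ s, Z j ω = u ∧ Z i ω = 0) ∨ (∑ j ∈ s, Z j ω + 1 = u ∧ Z i ω = 1)
      rw [Finset.sum_insert hi]
      omega
    have hd : Disjoint {ω | ∑ j ∈ s, Z j ω = u ∧ Z i ω = 0}
        {ω | ∑ j ∈ s, Z j ω + 1 = u ∧ Z i ω = 1} := by
      rw [Set.disjoint_left]
      rintro ω ⟨_, h⟩ ⟨_, h'⟩
      omega
    have hm : MeasurableSet {ω | ∑ j ∈ s, Z j ω + 1 = u ∧ Z i ω = 1} :=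
      ((hS.add_const 1) (MeasurableSet.singleton u)).inter (hZ i (MeasurableSet.singleton 1))
    rw [measure_congr hsplit, measure_union hd hm, hmul, ih, h0]
    rcases u with _ | u
    · have : {ω | ∑ j ∈ s, Z j ω + 1 = 0 ∧ Z i ω = 1} = ∅ := by
        ext ω
        simp
      rw [this, measure_empty, add_zero, ← ENNReal.ofReal_mul (by positivity)]
      simp [pow_succ]
    · have : {ω | ∑ j ∈ s, Z j ω + 1 = u + 1 ∧ Z i ω = 1} =
          {ω | ∑ j ∈ s, Z j ω = u ∧ Z i ω = 1} := by
        ext ω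
        simp
      rw [this, hmul, ih, h1, ← ENNReal.ofReal_mul (by positivity),
        ← ENNReal.ofReal_mul (by positivity), ← ENNReal.ofReal_add (by positivity) (by positivity)]
      congr 1
      rw [Nat.choose_succ_succ, Nat.succ_sub_succ]
      push_cast
      rcases lt_or_ge u s.card with hu | hu
      · have : s.card - u = s.card - (u + 1) + 1 := by omega
        rw [this]
        ring
      · rw [Nat.choose_eq_zero_of_lt (show s.card < u + 1 by omega)]
        push_cast
        ring

/-- One step of the chain from a fixed state has the law given by the transition matrix. -/
theorem IsBernoulliChannel.measure_update_increment [IsProbabilityMeasure μ]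
    (h : IsBernoulliChannel μ k p X Y₀) (hp : 0 ≤ p) (hp1 : p ≤ 1) (n i j : ℕ) :
    μ {ω | update i (increment X n ω) = j} = transition k p i j := by
  have hind : iIndepFun (X n) μ :=
    h.indep_loss.precomp (g := fun j => (n, j)) fun a b hab => (Prod.mk.inj hab).2
  have hmeas : Measurable fun ω => ∑ j, X n j ω :=
    Finset.measurable_fun_sum _ fun j _ => h.measurable_loss n j
  have hbin : ∀ u, μ ((fun ω => ∑ j, X n j ω) ⁻¹' {u}) = weight k p u := by
    intro u
    have := measure_sum_eq_binomial hp hp1 (h.measurable_loss n) (h.prob_lost n)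
      (h.prob_received n) hind Finset.univ u
    rwa [Finset.card_fin] at this
  have hset : {ω | update i (increment X n ω) = j} =
      (fun ω => ∑ j, X n j ω) ⁻¹' {u | i + u - 1 = j} := by
    ext ω
    simp only [Set.mem_ofPred_eq, Set.mem_preimage, increment, ← Nat.cast_sum, update_sub_one]
  rw [hset, ← tsum_measure_preimage_singleton (Set.to_countable _)
    fun u _ => hmeas (MeasurableSet.singleton u)]
  simp only [hbin]
  rw [tsum_subtype {u | i + u - 1 = j} (weight k p), transition_eq,
    tsum_eq_sum (s := Finset.range (k + 2))]
  · simp only [Set.indicator_apply, Set.mem_ofPred_eq]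
  · intro u hu
    have : k + 1 < u := by
      rw [Finset.mem_range] at hu
      omega
    rw [Set.indicator_apply_eq_zero]
    intro _
    simp [weight, Nat.choose_eq_zero_of_lt this]

/-! ### The Markov property -/

theorem measurable_increment (hX : ∀ n j, Measurable (X n j)) (n : ℕ) :
    Measurable (increment X n) :=
  (Finset.measurable_fun_sum _ fun j _ => (Measurable.of_discrete (f := ((↑) : ℕ → ℤ))).comp
    (hX n j)).sub_const 1

theorem measurable_chain (hX : ∀ n j, Measurable (X n j)) (hY : Measurable Y₀) (n : ℕ) :
    Measurable (chain X Y₀ n) := by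
  induction n with
  | zero => exact hY
  | succ n ih =>
    exact (Measurable.of_discrete (f := fun q : ℕ × ℤ => update q.1 q.2)).comp
      (ih.prodMk (measurable_increment hX n))

/-- The increments of the first `n` blocks are independent of the next one. -/
theorem IsBernoulliChannel.measure_increments_inter
    (h : IsBernoulliChannel μ k p X Y₀) (n : ℕ) (y : ℕ → ℕ) (i j : ℕ) :
    μ ({ω | ∀ m < n, update (y m) (increment X m ω) = y (m + 1)} ∩
        {ω | update i (increment X n ω) = j}) =
      μ {ω | ∀ m < n, update (y m) (increment X m ω) = y (m + 1)} *
        μ {ω | update i (increment X n ω) = j} := by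
  let S : Finset (ℕ × Fin (k + 1)) := Finset.range n ×ˢ Finset.univ
  let T : Finset (ℕ × Fin (k + 1)) := {n} ×ˢ Finset.univ
  have hST : Disjoint S T := by
    rw [Finset.disjoint_left]
    rintro ⟨m, j⟩ hS hT
    simp only [S, T, Finset.mem_product, Finset.mem_range, Finset.mem_singleton] at hS hT
    omega
  have hS : ∀ m < n, ∀ j, (m, j) ∈ S := fun m hm j => by simp [S, hm]
  have hT : ∀ j, (n, j) ∈ T := fun j => by simp [T]
  exact (h.indep_loss.indepFun_finset S T hST fun q => h.measurable_loss q.1 q.2)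
    |>.measure_inter_preimage_eq_mul
    {x | ∀ m, ∀ hm : m < n, update (y m) ((∑ j, (x ⟨(m, j), hS m hm j⟩ : ℤ)) - 1) = y (m + 1)}
    {x | update i ((∑ j, (x ⟨(n, j), hT j⟩ : ℤ)) - 1) = j} .of_discrete .of_discrete

theorem IsBernoulliChannel.measure_init_inter
    (h : IsBernoulliChannel μ k p X Y₀) {C : Set (ℕ × Fin (k + 1) → ℕ)} (hC : MeasurableSet C)
    (i : ℕ) : μ ({ω | Y₀ ω = i} ∩ {ω | (fun q : ℕ × Fin (k + 1) => X q.1 q.2 ω) ∈ C}) =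
      μ {ω | Y₀ ω = i} * μ {ω | (fun q : ℕ × Fin (k + 1) => X q.1 q.2 ω) ∈ C} :=
  h.indep_init.measure_inter_preimage_eq_mul {i} C (MeasurableSet.singleton i) hC

/-- The Markov property in product form, without division by the probability of the past. -/
theorem IsBernoulliChannel.measure_path_inter [IsProbabilityMeasure μ]
    (h : IsBernoulliChannel μ k p X Y₀) (hp : 0 ≤ p) (hp1 : p ≤ 1) (n : ℕ) (y : ℕ → ℕ) (j : ℕ) :
    μ ({ω | ∀ m ≤ n, chain X Y₀ m ω = y m} ∩ {ω | chain X Y₀ (n + 1) ω = j}) =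
      μ {ω | ∀ m ≤ n, chain X Y₀ m ω = y m} * transition k p (y n) j := by
  have hset : {ω | ∀ m ≤ n, chain X Y₀ m ω = y m} ∩ {ω | chain X Y₀ (n + 1) ω = j} =
      {ω | ∀ m ≤ n, chain X Y₀ m ω = y m} ∩ {ω | update (y n) (increment X n ω) = j} := by
    ext ω
    refine and_congr_right fun hω => ?_
    have := hω n le_rfl
    simp only [Set.mem_ofPred_eq, chain, this]
  -- the losses as coordinates of the space of all loss patterns
  let X' : ℕ → Fin (k + 1) → (ℕ × Fin (k + 1) → ℕ) → ℕ := fun n j x => x (n, j)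
  have hinc : ∀ m i j, MeasurableSet {x | update i (increment X' m x) = j} := fun m i j =>
    (Measurable.of_discrete (f := update i)).comp
      (measurable_increment (fun n j => measurable_pi_apply (n, j)) m) (MeasurableSet.singleton j)
  have hpath : MeasurableSet {x | ∀ m < n, update (y m) (increment X' m x) = y (m + 1)} := by
    simp only [Set.ofPred_forall]
    exact MeasurableSet.iInter fun m => MeasurableSet.iInter fun _ => hinc m _ _
  have h1 := h.measure_init_inter hpath (y 0)
  have h2 := h.measure_init_inter (hpath.inter (hinc n (y n) j)) (y 0)
  have h3 := h.measure_increments_inter n y (y n) j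
  rw [h.measure_update_increment hp hp1] at h3
  rw [hset, setOf_chain_eq, Set.inter_assoc]
  refine h2.trans (Eq.trans ?_ (congrArg (· * _) h1.symm))
  rw [mul_assoc]
  exact congrArg _ h3

theorem IsBernoulliChannel.isMarkovChain [IsProbabilityMeasure μ]
    (h : IsBernoulliChannel μ k p X Y₀) (hp : 0 ≤ p) (hp1 : p ≤ 1) :
    IsMarkovChain μ (chain X Y₀) (transition k p) := by
  intro n y hy j
  have hm : MeasurableSet {ω | ∀ m ≤ n, chain X Y₀ m ω = y m} := by
    simp only [Set.ofPred_forall]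
    exact MeasurableSet.iInter fun m => MeasurableSet.iInter fun _ =>
      measurable_chain h.measurable_loss h.measurable_init m (MeasurableSet.singleton _)
  rw [cond_apply hm, h.measure_path_inter hp hp1, ← mul_assoc,
    ENNReal.inv_mul_cancel hy (measure_ne_top _ _), one_mul]

/-- The joint law of two successive states, obtained by summing over the paths up to time `n`. -/
theorem IsBernoulliChannel.measure_chain_inter [IsProbabilityMeasure μ]
    (h : IsBernoulliChannel μ k p X Y₀) (hp : 0 ≤ p) (hp1 : p ≤ 1) (n i j : ℕ) :
    μ ({ω | chain X Y₀ n ω = i} ∩ {ω | chain X Y₀ (n + 1) ω = j}) =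
      μ {ω | chain X Y₀ n ω = i} * transition k p i j := by
  have hY := measurable_chain h.measurable_loss h.measurable_init
  let H : Ω → Fin (n + 1) → ℕ := fun ω m => chain X Y₀ m ω
  have hH : Measurable H := measurable_pi_lambda _ fun m => hY m
  let s : Set (Fin (n + 1) → ℕ) := {y | y (Fin.last n) = i}
  have hfib : ∀ y ∈ s, MeasurableSet (H ⁻¹' {y}) := fun y _ => hH (MeasurableSet.singleton y)
  have hs : ∀ ν : Measure Ω, ν {ω | chain X Y₀ n ω = i} = ∑' y : s, ν (H ⁻¹' {↑y}) := fun ν =>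
    (tsum_measure_preimage_singleton (Set.to_countable s) hfib).symm
  have h1 := hs (μ.restrict {ω | chain X Y₀ (n + 1) ω = j})
  have hi : MeasurableSet {ω | chain X Y₀ n ω = i} := hY n (MeasurableSet.singleton i)
  rw [Measure.restrict_apply hi] at h1
  rw [h1, hs μ, ← ENNReal.tsum_mul_right]
  refine tsum_congr fun ⟨y, hy⟩ => ?_
  rw [Measure.restrict_apply (hfib y hy)]
  have hpath : H ⁻¹' {y} =
      {ω | ∀ m ≤ n, chain X Y₀ m ω = if hm : m < n + 1 then y ⟨m, hm⟩ else 0} := by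
    ext ω
    constructor
    · rintro rfl m hm
      rw [dif_pos (by omega)]
    · intro hω
      funext m
      have := hω m (by omega)
      rwa [dif_pos m.2] at this
  rw [hpath, h.measure_path_inter hp hp1, dif_pos (Nat.lt_succ_self n)]
  have : y ⟨n, Nat.lt_succ_self n⟩ = i := hy
  rw [this]

theorem IsBernoulliChannel.cond_chain_succ [IsProbabilityMeasure μ]
    (h : IsBernoulliChannel μ k p X Y₀) (hp : 0 ≤ p) (hp1 : p ≤ 1) (n i j : ℕ)
    (hi : μ {ω | chain X Y₀ n ω = i} ≠ 0) :
    μ[{ω | chain X Y₀ (n + 1) ω = j} | {ω | chain X Y₀ n ω = i}] = transition k p i j := by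
  have hm : MeasurableSet {ω | chain X Y₀ n ω = i} :=
    measurable_chain h.measurable_loss h.measurable_init n (MeasurableSet.singleton i)
  rw [cond_apply hm, h.measure_chain_inter hp hp1, ← mul_assoc,
    ENNReal.inv_mul_cancel hi (measure_ne_top _ _), one_mul]

theorem IsBernoulliChannel.measure_chain_succ [IsProbabilityMeasure μ]
    (h : IsBernoulliChannel μ k p X Y₀) (hp : 0 ≤ p) (hp1 : p ≤ 1) (n j : ℕ) :
    μ {ω | chain X Y₀ (n + 1) ω = j} =
      ∑' i, μ {ω | chain X Y₀ n ω = i} * transition k p i j := by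
  have hY := measurable_chain h.measurable_loss h.measurable_init
  have h1 := tsum_measure_preimage_singleton (μ := μ.restrict {ω | chain X Y₀ (n + 1) ω = j})
    (Set.to_countable Set.univ) fun y _ => hY n (MeasurableSet.singleton y)
  rw [tsum_univ (fun y => μ.restrict {ω | chain X Y₀ (n + 1) ω = j} (chain X Y₀ n ⁻¹' {y})),
    Set.preimage_univ, Measure.restrict_apply_univ] at h1
  rw [← h1]
  refine tsum_congr fun i => ?_
  rw [Measure.restrict_apply (hY n (MeasurableSet.singleton i)),
    ← h.measure_chain_inter hp hp1]
  rfl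

theorem IsBernoulliChannel.measure_chain_of_stationary [IsProbabilityMeasure μ]
    (h : IsBernoulliChannel μ k p X Y₀) (hp : 0 ≤ p) (hp1 : p ≤ 1) {π : ℕ → ℝ≥0∞}
    (hπ : IsStationaryDistribution (transition k p) π) (h0 : ∀ i, μ {ω | Y₀ ω = i} = π i)
    (n i : ℕ) : μ {ω | chain X Y₀ n ω = i} = π i := by
  induction n generalizing i with
  | zero => exact h0 i
  | succ n ih =>
    rw [h.measure_chain_succ hp hp1]
    simp only [ih]
    exact hπ.2 i

end Channel

end Tetrys

/-! ### The chain of a channel with loss rate below the redundancy ratio -/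

theorem mainTheorem2 (k : ℕ) (hk : 1 ≤ k) (p : ℝ) (hp : 0 < p)
    (hR : p < Tetrys.redundancyRatio k) :
    -- `{Y_n}` is a Markov chain and `transition k p` holds its transition probabilities
    (∀ (Ω : Type*) [MeasurableSpace Ω] (μ : Measure Ω) [IsProbabilityMeasure μ]
        (X : ℕ → Fin (k + 1) → Ω → ℕ) (Y₀ : Ω → ℕ), Tetrys.IsBernoulliChannel μ k p X Y₀ →
      Tetrys.IsMarkovChain μ (Tetrys.chain X Y₀) (Tetrys.transition k p) ∧
      ∀ n i j, μ {ω | Tetrys.chain X Y₀ n ω = i} ≠ 0 →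
        μ[{ω | Tetrys.chain X Y₀ (n + 1) ω = j} | {ω | Tetrys.chain X Y₀ n ω = i}] =
          Tetrys.transition k p i j) ∧
    Tetrys.IsIrreducible (Tetrys.transition k p) ∧
    (∀ i, Tetrys.PositiveRecurrent (Tetrys.transition k p) i) ∧
    ∃ π : ℕ → ℝ≥0∞, Tetrys.IsStationaryDistribution (Tetrys.transition k p) π ∧
      (∀ j i, Tendsto (fun n => Tetrys.nStep (Tetrys.transition k p) n j i) atTop (𝓝 (π i))) ∧
      -- in the stationary regime, `P(Y_n = i) = π i` for every `n`
      (∀ (Ω : Type*) [MeasurableSpace Ω] (μ : Measure Ω) [IsProbabilityMeasure μ]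
          (X : ℕ → Fin (k + 1) → Ω → ℕ) (Y₀ : Ω → ℕ), Tetrys.IsBernoulliChannel μ k p X Y₀ →
        (∀ i, μ {ω | Y₀ ω = i} = π i) →
          ∀ n i, μ {ω | Tetrys.chain X Y₀ n ω = i} = π i) := by
  have hp1 : p < 1 := by
    refine hR.trans_le ?_
    rw [Tetrys.redundancyRatio, div_le_one (by positivity)]
    linarith [Nat.cast_nonneg (α := ℝ) k]
  refine ⟨fun Ω _ μ _ X Y₀ h => ⟨h.isMarkovChain hp.le hp1.le, h.cond_chain_succ hp.le hp1.le⟩,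
    Tetrys.isIrreducible_transition hk hp hp1,
    Tetrys.positiveRecurrent_transition hk hp hp1 hR,
    Tetrys.limitLaw k p, Tetrys.isStationaryDistribution_limitLaw hp hp1 hR,
    Tetrys.tendsto_nStep_transition hp hp1 hR, fun Ω _ μ _ X Y₀ h h0 => ?_⟩
  exact h.measure_chain_of_stationary hp.le hp1.le
    (Tetrys.isStationaryDistribution_limitLaw hp hp1 hR) h0
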